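/- Let $K$ be a field of characteristic zero and let $U_1=\mathrm{Der}\,K[t,t^{-1}]$ be the Lie algebra of derivations of the Laurent polynomial algebra, with the $\mathbb{Z}$-grading $U_1=\bigoplus_{n\in\mathbb{Z}}L_n$, where $L_n$ is the span of $e_n=t^{n+1}\,d/dt$. Let $L\langle X_{\mathbb{Z}}\rangle$ be the free Lie algebra over $K$ on the variables $x_i^g$ ($g\in\mathbb{Z}$, $i=1,2,\ldots$), $\mathbb{Z}$-graded so that $x_i^g$ has degree $g$. A polynomial $f\in L\langle X_{\mathbb{Z}}\rangle$ is a graded identity of $U_1$, written $f\equiv 0$, if $f$ vanishes whenever each variable $x_i^g$ is replaced by an element of $L_g$. A $T_{\mathbb{Z}}$-ideal is an ideal of $L\langle X_{\mathbb{Z}}\rangle$ that is invariant under all degree-preserving Lie endomorphisms of $L\langle X_{\mathbb{Z}}\rangle$, and a set $S$ of graded identities of $U_1$ is a basis of these identities if the smallest $T_{\mathbb{Z}}$-ideal containing $S$ is the set of all graded identities of $U_1$. Write $[u,v,w]=[[u,v],w]$. Then the graded identities $$[x_1^i,x_2^i]\equiv 0\qquad (i\in\mathbb{Z}),$$ $$\alpha\,[x_1^a,x_2^b,x_3^c]-\beta\,[x_1^a,x_3^c,x_2^b]\equiv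 0\qquad (a,b,c\in\mathbb{Z}),$$ where $\alpha=(c-a)(b-c-a)$ and $\beta=(b-a)(c-b-a)$, form a basis of the $\mathbb{Z}$-graded identities of $U_1$ over $K$. -/

import Mathlib

open scoped LaurentPolynomial

/-! ### The Lie algebra `U₁` of derivations of `K[t, t⁻¹]` and its `ℤ`-grading -/

/-- The Lie algebra `U₁ = Der K[t, t⁻¹]`, with the commutator bracket. -/
abbrev U₁ (K : Type*) [Field K] : Type _ :=
  Derivation K K[T;T⁻¹] K[T;T⁻¹]

namespace U₁

/-- The `K`-linear map `d/dt` on `K[t, t⁻¹]`: it sends `tⁿ` to `n tⁿ⁻¹`. -/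
noncomputable def ddtLinear (K : Type*) [Field K] : K[T;T⁻¹] →ₗ[K] K[T;T⁻¹] :=
  (Finsupp.linearCombination K fun n : ℤ => (n : K) • LaurentPolynomial.T (n - 1)) ∘ₗ
    (AddMonoidAlgebra.coeffLinearEquiv K).toLinearMap

theorem ddtLinear_C_mul_T (K : Type*) [Field K] (c : K) (n : ℤ) :
    ddtLinear K (LaurentPolynomial.C c * LaurentPolynomial.T n) =
      LaurentPolynomial.C (c * n) * LaurentPolynomial.T (n - 1) := by
  rw [← LaurentPolynomial.single_eq_C_mul_T, ddtLinear, LinearMap.comp_apply]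
  change Finsupp.linearCombination K _ (Finsupp.single n c) = _
  rw [Finsupp.linearCombination_single, smul_smul, LaurentPolynomial.smul_eq_C_mul]

theorem ddtLinear_leibniz (K : Type*) [Field K] (p q : K[T;T⁻¹]) :
    ddtLinear K (p * q) = p • ddtLinear K q + q • ddtLinear K p := by
  induction p using LaurentPolynomial.induction_on' with
  | add p₁ p₂ h₁ h₂ => simp only [add_mul, map_add, h₁, h₂, smul_add, add_smul]; abel
  | C_mul_T m a =>
    induction q using LaurentPolynomial.induction_on' with
    | add q₁ q₂ h₁ h₂ => simp only [mul_add, map_add, h₁, h₂, smul_add, add_smul]; abel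
    | C_mul_T n b =>
      have e : LaurentPolynomial.C a * LaurentPolynomial.T m *
          (LaurentPolynomial.C b * LaurentPolynomial.T n) =
          LaurentPolynomial.C (a * b) * LaurentPolynomial.T (m + n) := by
        rw [LaurentPolynomial.T_add, map_mul]; ring
      have e₁ : (LaurentPolynomial.T (m + n - 1) : K[T;T⁻¹]) =
          LaurentPolynomial.T m * LaurentPolynomial.T (n - 1) := by
        rw [← LaurentPolynomial.T_add]; congr 1; ring
      have e₂ : (LaurentPolynomial.T n * LaurentPolynomial.T (m - 1) : K[T;T⁻¹]) =
          LaurentPolynomial.T m * LaurentPolynomial.T (n - 1) := by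
        rw [← LaurentPolynomial.T_add, ← LaurentPolynomial.T_add]; congr 1; ring
      rw [e, ddtLinear_C_mul_T, ddtLinear_C_mul_T, ddtLinear_C_mul_T, e₁, smul_eq_mul, smul_eq_mul,
        mul_mul_mul_comm, mul_mul_mul_comm (LaurentPolynomial.C b), e₂]
      simp only [map_mul, Int.cast_add, map_add]
      ring

/-- The derivation `d/dt` of `K[t, t⁻¹]`. -/
noncomputable def ddt (K : Type*) [Field K] : U₁ K :=
  Derivation.mk' (ddtLinear K) (ddtLinear_leibniz K)

/-- The derivation `e_n = t^(n+1) d/dt` of `K[t, t⁻¹]`, for `n ∈ ℤ`. -/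
noncomputable def e (K : Type*) [Field K] (n : ℤ) : U₁ K :=
  (LaurentPolynomial.T (n + 1) : K[T;T⁻¹]) • ddt K

/-- The homogeneous component of degree `n` in the `ℤ`-grading of `U₁`: the span of `e_n`. -/
noncomputable def component (K : Type*) [Field K] (n : ℤ) : Submodule K (U₁ K) :=
  Submodule.span K {e K n}

end U₁

/-! ### Graded polynomials, graded identities and `T_G`-ideals -/

/-- The free `G`-graded Lie algebra `L⟨X_G⟩`: the free Lie algebra on the variables
`x_i^g`, with `g ∈ G` and `i ∈ ℕ`; the variable `x_i^g` is indexed by the pair `(g, i)`. -/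
abbrev FreeGradedLie (K : Type*) [Field K] (G : Type*) : Type _ :=
  FreeLieAlgebra K (G × ℕ)

namespace FreeGradedLie

/-- The variable `x_i^g`. -/
noncomputable def x (K : Type*) [Field K] {G : Type*} (i : ℕ) (g : G) : FreeGradedLie K G :=
  FreeLieAlgebra.of K (g, i)

/-- `IsCommutator g m` says that `m` is a commutator in the variables, with an arbitrary
arrangement of brackets, and that the degrees of the variables in it add up to `g`. -/
inductive IsCommutator {K : Type*} [Field K] {G : Type*} [AddCommGroup G] :
    G → FreeGradedLie K G → Prop
  | var (i : ℕ) (g : G) : IsCommutator g (x K i g)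
  | lie {g h : G} {u v : FreeGradedLie K G} :
      IsCommutator g u → IsCommutator h v → IsCommutator (g + h) ⁅u, v⁆

/-- The homogeneous component of degree `g` of `L⟨X_G⟩`. -/
noncomputable def component (K : Type*) [Field K] {G : Type*} [AddCommGroup G] (g : G) :
    Submodule K (FreeGradedLie K G) :=
  Submodule.span K {m | IsCommutator g m}

/-- An endomorphism of the Lie algebra `L⟨X_G⟩` is graded if it preserves degrees. -/
def IsGradedEnd {K : Type*} [Field K] {G : Type*} [AddCommGroup G]
    (φ : FreeGradedLie K G →ₗ⁅K⁆ FreeGradedLie K G) : Prop :=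
  ∀ g : G, ∀ f ∈ component K g, φ f ∈ component K g

/-- A `T_G`-ideal: a Lie ideal of `L⟨X_G⟩` invariant under all graded endomorphisms. -/
def IsTIdeal {K : Type*} [Field K] {G : Type*} [AddCommGroup G]
    (I : LieIdeal K (FreeGradedLie K G)) : Prop :=
  ∀ φ : FreeGradedLie K G →ₗ⁅K⁆ FreeGradedLie K G, IsGradedEnd φ → ∀ f ∈ I, φ f ∈ I

/-- The `T_G`-ideal `⟨S⟩_G` generated by `S`: the intersection of all `T_G`-ideals containing
`S`. -/
noncomputable def tIdealSpan {K : Type*} [Field K] {G : Type*} [AddCommGroup G]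
    (S : Set (FreeGradedLie K G)) : LieIdeal K (FreeGradedLie K G) :=
  sInf {I | IsTIdeal I ∧ S ⊆ I}

/-- The graded polynomial `f` is a graded identity of the Lie algebra `L` with homogeneous
components `𝒜 g`: it vanishes under every substitution of the variables `x_i^g` by elements of
`𝒜 g`. -/
def IsGradedIdentity {K : Type*} [Field K] {G : Type*} {L : Type*} [LieRing L] [LieAlgebra K L]
    (𝒜 : G → Submodule K L) (f : FreeGradedLie K G) : Prop :=
  ∀ a : G × ℕ → L, (∀ g i, a (g, i) ∈ 𝒜 g) → FreeLieAlgebra.lift K a f = 0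

/-- `S` is a basis of the graded identities of `L`: the `T_G`-ideal generated by `S` consists
exactly of the graded identities of `L`. -/
def IsBasisOfGradedIdentities {K : Type*} [Field K] {G : Type*} [AddCommGroup G] {L : Type*}
    [LieRing L] [LieAlgebra K L] (𝒜 : G → Submodule K L) (S : Set (FreeGradedLie K G)) : Prop :=
  ∀ f : FreeGradedLie K G, f ∈ tIdealSpan S ↔ IsGradedIdentity 𝒜 f

end FreeGradedLie

/-!
Modulo the basic identities, the bracket of homogeneous elements of degrees `a ≠ b`, divided by
`b - a`, is a commutative product, defined for distinct degrees only, and `(x y) z = (x z) y`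
whenever both sides are defined. The crux is that any two defined products of the same elements
agree. Up to a sign change the total degree is nonnegative, and by induction it suffices to
transform a product into one that starts by multiplying the two elements of largest degree. The
swaps that achieve this need an intermediate product to exist. It does exist unless an arithmetic
obstruction occurs: some `g ≥ 0` divides all degrees and is at least as large as each of them,
while these add up to at least `2 g`.

So a commutator in the variables is, modulo the basic identities, the product of its variables
times the coefficient of its value in `U₁` under `x_i^g ↦ e_g`. Under `x_i^g ↦ r_i^g e_g` a
polynomial `f` takes a value whose coefficients, as polynomials in the scalars `r_i^g`, recover
`f` modulo the basic identities. If `f` is a graded identity, they vanish, since `K` is infinite.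
-/

section Saturated

variable {M h a x : ℤ} {s : Multiset ℤ}

theorem eq_of_dvd_of_pos_of_le {g a : ℤ} (h : g ∣ a) (h₀ : 0 < a) (h₁ : a ≤ g) : a = g :=
  le_antisymm h₁ (Int.le_of_dvd h₀ h)

theorem add_le_of_dvd_of_le {g a b : ℤ} (hg : 0 ≤ g) (ha : g ∣ a) (hb : g ∣ b) (hag : a ≤ g)
    (hbg : b ≤ g) (h : a ≠ b) : a + b ≤ g := by
  by_cases ha₀ : 0 < a
  · obtain rfl := eq_of_dvd_of_pos_of_le ha ha₀ hag
    have : ¬ 0 < b := fun hb₀ => h (eq_of_dvd_of_pos_of_le hb hb₀ hbg).symm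
    omega
  · omega

theorem sum_nonpos_of_forall_nonpos (hs : ∀ a ∈ s, a ≤ 0) : s.sum ≤ 0 := by
  simpa using Multiset.sum_le_card_nsmul s 0 hs

theorem sum_le_of_mem_of_forall_nonpos (hs : ∀ a ∈ s, a ≤ 0) (ha : a ∈ s) : s.sum ≤ a := by
  obtain ⟨s, rfl⟩ := Multiset.exists_cons_of_mem ha
  rw [Multiset.forall_mem_cons] at hs
  rw [Multiset.sum_cons]
  exact add_le_of_nonpos_right (sum_nonpos_of_forall_nonpos hs.2)

/-- The obstruction to multiplying together factors with the degrees `s`. If `g ≥ 0` divides two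
distinct degrees that are at most `g`, then their sum is at most `g` too. So no partial product
leaves the multiples of `g` that are at most `g`, and a last product of two distinct ones of these
has degree less than `2 * g`. -/
def Saturated (s : Multiset ℤ) : Prop :=
  ∃ g, 0 ≤ g ∧ (∀ a ∈ s, g ∣ a ∧ a ≤ g) ∧ 2 * g ≤ s.sum

theorem saturated_of_forall_eq_zero (hs : ∀ a ∈ s, a = 0) : Saturated s :=
  ⟨0, le_rfl, fun a ha => by simp [hs a ha], (Multiset.sum_eq_zero hs).ge⟩

theorem not_saturated_cons_of_forall_lt (hx : 0 < x) (hs : ∀ a ∈ s, a < x) :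
    ¬ Saturated (x ::ₘ s) := by
  rintro ⟨g, -, hg, hsum⟩
  rw [Multiset.forall_mem_cons] at hg
  rw [Multiset.sum_cons] at hsum
  obtain rfl : x = g := eq_of_dvd_of_pos_of_le hg.1.1 hx hg.1.2
  have : s.sum ≤ 0 := sum_nonpos_of_forall_nonpos fun a ha => by
    by_contra! h₀
    exact (hs a ha).ne (eq_of_dvd_of_pos_of_le (hg.2 a ha).1 h₀ (hg.2 a ha).2)
  omega

theorem saturated_iff_of_mem (hM : 0 < M) (hMs : M ∈ s) :
    Saturated s ↔ (∀ a ∈ s, M ∣ a ∧ a ≤ M) ∧ 2 * M ≤ s.sum := by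
  refine ⟨fun ⟨g, _, hg, hsum⟩ => ?_, fun h => ⟨M, hM.le, h⟩⟩
  obtain rfl : M = g := eq_of_dvd_of_pos_of_le (hg M hMs).1 hM (hg M hMs).2
  exact ⟨hg, hsum⟩

theorem mem_of_le_sum {g : ℤ} (hs₀ : s ≠ 0) (hg : 0 ≤ g) (hs : ∀ a ∈ s, g ∣ a ∧ a ≤ g)
    (hsum : g ≤ s.sum) : g ∈ s := by
  by_contra hgs
  have hle : ∀ a ∈ s, a ≤ 0 := fun a ha => by
    by_contra! h₀
    exact hgs (eq_of_dvd_of_pos_of_le (hs a ha).1 h₀ (hs a ha).2 ▸ ha)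
  obtain ⟨a, ha⟩ := Multiset.exists_mem_of_ne_zero hs₀
  have := sum_le_of_mem_of_forall_nonpos hle ha
  have := hle a ha
  exact hgs ((by omega : a = g) ▸ ha)

theorem Saturated.mem_of_neg {b y : ℤ} (hsat : Saturated (y ::ₘ a ::ₘ s)) (ha : a < 0)
    (hs : ∀ c ∈ s, c = b ∨ c ≤ 0) : b ∈ s := by
  obtain ⟨g, hg, hdvd, hge⟩ := hsat
  simp only [Multiset.forall_mem_cons, Multiset.sum_cons] at hdvd hge
  by_contra hb
  have : s.sum ≤ 0 := sum_nonpos_of_forall_nonpos fun c hc =>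
    (hs c hc).resolve_left fun e => hb (e ▸ hc)
  omega

theorem ne_and_not_saturated_add_of_nonpos (h₀ : h ≤ 0) (hle : ∀ a ∈ s, a ≤ h) (hs₀ : s ≠ 0)
    (hsum : 0 ≤ (x ::ₘ h ::ₘ s).sum) (hS : ¬ Saturated (x ::ₘ h ::ₘ s)) :
    x ≠ h ∧ ¬ Saturated ((x + h) ::ₘ s) := by
  have hsum_le : ∀ a ∈ s, s.sum ≤ a := fun a =>
    sum_le_of_mem_of_forall_nonpos fun b hb => (hle b hb).trans h₀
  obtain ⟨a, ha⟩ := Multiset.exists_mem_of_ne_zero hs₀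
  have hah := hle a ha
  have has := hsum_le a ha
  rw [Multiset.sum_cons, Multiset.sum_cons] at hsum
  have hxh : ¬ (x = 0 ∧ h = 0) := fun ⟨hx, hh⟩ => hS <| saturated_of_forall_eq_zero <| by
    simp only [Multiset.forall_mem_cons]
    exact ⟨hx, hh, fun b hb => by have := hle b hb; have := hsum_le b hb; omega⟩
  refine ⟨by omega, fun ⟨g, hg, hdvd, hge⟩ => ?_⟩
  simp only [Multiset.forall_mem_cons, Multiset.sum_cons] at hdvd hge
  omega

/-- `M` is the largest element of `M ::ₘ h ::ₘ s`, it is positive, and `h` is the largest of the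
elements other than `M`. -/
structure IsTopTwo (M h : ℤ) (s : Multiset ℤ) : Prop where
  pos : 0 < M
  lt : h < M
  eq_or_le : ∀ a ∈ s, a = M ∨ a ≤ h

namespace IsTopTwo

theorem le (H : IsTopTwo M h s) : ∀ a ∈ s, a ≤ M := fun a ha =>
  (H.eq_or_le a ha).elim le_of_eq fun h => h.trans H.lt.le

theorem forall_le (H : IsTopTwo M h s) (hMs : M ∉ s) : ∀ a ∈ s, a ≤ h := fun a ha =>
  (H.eq_or_le a ha).resolve_left fun e => hMs (e ▸ ha)

theorem not_saturated_add (H : IsTopTwo M h s) (hsum : 0 ≤ (M ::ₘ h ::ₘ s).sum)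
    (hS : ¬ Saturated (M ::ₘ h ::ₘ s)) (hs₀ : s ≠ 0) : ¬ Saturated ((M + h) ::ₘ s) := by
  have hM := H.pos
  rcases lt_or_ge 0 h with h₀ | h₀
  · exact not_saturated_cons_of_forall_lt (by omega) fun a ha => by linarith [H.le a ha]
  by_cases hMs : M ∈ s
  · rw [saturated_iff_of_mem hM (by simp)] at hS
    rw [saturated_iff_of_mem hM (by simp [hMs])]
    refine fun ⟨hdvd, hle⟩ => hS ?_
    simp only [Multiset.forall_mem_cons, Multiset.sum_cons] at hdvd hle ⊢
    exact ⟨⟨⟨dvd_rfl, le_rfl⟩, ⟨(dvd_add_right dvd_rfl).1 hdvd.1.1, H.lt.le⟩, hdvd.2⟩,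
      by linarith⟩
  · exact (ne_and_not_saturated_add_of_nonpos h₀ (H.forall_le hMs) hs₀ hsum hS).2

theorem not_saturated_disjoint (H : IsTopTwo M h (M ::ₘ s)) (ha : a ≤ h) (h₀ : h < 0)
    (hS : ¬ Saturated ((M + a) ::ₘ h ::ₘ M ::ₘ s)) (hne : a ≠ h ∨ s ≠ 0) :
    ¬ Saturated ((M + a) ::ₘ (h + M) ::ₘ s) := by
  have hM := H.pos
  have hlt := H.lt
  rw [saturated_iff_of_mem hM (by simp)] at hS
  rintro ⟨g, hg, hdvd, hge⟩
  simp only [Multiset.forall_mem_cons, Multiset.sum_cons] at hdvd hge hS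
  by_cases hMs : M ∈ s
  · obtain rfl : M = g := eq_of_dvd_of_pos_of_le (hdvd.2.2 M hMs).1 hM (hdvd.2.2 M hMs).2
    exact hS ⟨⟨hdvd.1, ⟨(dvd_add_left dvd_rfl).1 hdvd.2.1.1, hlt.le⟩, ⟨dvd_rfl, le_rfl⟩,
      hdvd.2.2⟩, by linarith⟩
  · have hle : ∀ b ∈ s, b ≤ h := fun b hb =>
      (H.eq_or_le b (Multiset.mem_cons_of_mem hb)).resolve_left fun e => hMs (e ▸ hb)
    rcases s.empty_or_exists_mem with rfl | ⟨b, hb⟩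
    · simp only [Multiset.sum_zero, ne_eq, not_true_eq_false, or_false] at hge hne
      omega
    · have := sum_le_of_mem_of_forall_nonpos (fun b hb => (hle b hb).trans h₀.le) hb
      have := hle b hb
      omega

theorem not_saturated_two_max (H : IsTopTwo M h (M ::ₘ s)) (ha : a ≤ h) (h₀ : h < 0)
    (hS : ¬ Saturated ((M + a) ::ₘ h ::ₘ M ::ₘ s)) : ¬ Saturated ((h + M + M) ::ₘ a ::ₘ s) := by
  intro hsat
  have hMs : M ∈ s := hsat.mem_of_neg (by omega) fun b hb =>
    (H.eq_or_le b (Multiset.mem_cons_of_mem hb)).imp_right fun hb => hb.trans h₀.le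
  rw [saturated_iff_of_mem H.pos (by simp [hMs])] at hsat
  rw [saturated_iff_of_mem H.pos (by simp)] at hS
  simp only [Multiset.forall_mem_cons, Multiset.sum_cons] at hsat hS
  obtain ⟨⟨⟨hdvd, -⟩, hda, hds⟩, _⟩ := hsat
  rw [dvd_add_left dvd_rfl, dvd_add_left dvd_rfl] at hdvd
  exact hS ⟨⟨⟨dvd_add dvd_rfl hda.1, by omega⟩, ⟨hdvd, H.lt.le⟩, ⟨dvd_rfl, le_rfl⟩, hds⟩,
    by linarith⟩

theorem exists_mem_of_saturated_add (H : IsTopTwo M h s) (h₀ : 0 < h) (hMs : M ∉ s) (hs₀ : s ≠ 0)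
    (hS : ¬ Saturated ((M + a) ::ₘ h ::ₘ s)) (hsat : Saturated ((M + a + h) ::ₘ s)) :
    M + a < 0 ∧ ∃ l ∈ s, 0 ≤ l ∧ l < h ∧ ∀ b ∈ s, b ≤ l := by
  obtain ⟨g, hg, hdvd, hge⟩ := hsat
  simp only [Multiset.forall_mem_cons, Multiset.sum_cons] at hdvd hge
  have hgs : g ∈ s := mem_of_le_sum hs₀ hg hdvd.2 (by omega)
  have hgh : g ≠ h := by
    rintro rfl
    refine hS ((saturated_iff_of_mem h₀ (by simp)).2 ?_)
    simp only [Multiset.forall_mem_cons, Multiset.sum_cons]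
    exact ⟨⟨⟨(dvd_add_left dvd_rfl).1 hdvd.1.1, by omega⟩, ⟨dvd_rfl, le_rfl⟩, hdvd.2⟩,
      by linarith⟩
  have := H.forall_le hMs g hgs
  exact ⟨by omega, g, hgs, hg, by omega, fun b hb => (hdvd.2 b hb).2⟩

end IsTopTwo

theorem exists_nonpos_of_not_saturated (h₀ : 0 < h) (hs₀ : ∀ b ∈ s, b = h ∨ b ≤ 0)
    (hS : ¬ Saturated (h ::ₘ h ::ₘ s)) : ∃ b ∈ s, b ≤ 0 := by
  by_contra! hpos
  have heq : ∀ b ∈ s, b = h := fun b hb => (hs₀ b hb).resolve_right (hpos b hb).not_ge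
  have hsum : 0 ≤ s.sum := Multiset.sum_nonneg fun b hb => (hpos b hb).le
  refine hS ((saturated_iff_of_mem h₀ (by simp)).2 ?_)
  simp only [Multiset.forall_mem_cons, Multiset.sum_cons]
  exact ⟨⟨⟨dvd_rfl, le_rfl⟩, ⟨dvd_rfl, le_rfl⟩, fun b hb => by simp [heq b hb]⟩, by linarith⟩

theorem not_saturated_cons_add (h₀ : 0 < h) (hx : x ≤ 0)
    (hS : ¬ Saturated (h ::ₘ h ::ₘ x ::ₘ s)) : ¬ Saturated (h ::ₘ (h + x) ::ₘ s) := by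
  rw [saturated_iff_of_mem h₀ (by simp)] at hS ⊢
  simp only [Multiset.forall_mem_cons, Multiset.sum_cons] at hS ⊢
  refine fun ⟨⟨hh, hdvd, hs⟩, hge⟩ => hS ⟨⟨hh, hh, ?_, hs⟩, by linarith only [hge]⟩
  exact ⟨(dvd_add_right dvd_rfl).1 hdvd.1, by omega⟩

theorem not_saturated_cons_cons_of_neg (h₀ : 0 < h) (ha : a < 0) (hx : x ≤ 0)
    (hs₀ : ∀ b ∈ s, b = h ∨ b ≤ 0) (hS : ¬ Saturated (h ::ₘ h ::ₘ x ::ₘ s)) :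
    ¬ Saturated ((h + x + (h - a)) ::ₘ a ::ₘ s) := by
  intro hsat
  have hhs := hsat.mem_of_neg ha hs₀
  rw [saturated_iff_of_mem h₀ (by simp [hhs])] at hsat
  rw [saturated_iff_of_mem h₀ (by simp)] at hS
  simp only [Multiset.forall_mem_cons, Multiset.sum_cons] at hsat hS
  obtain ⟨⟨⟨hdvd, -⟩, hda, hds⟩, hge⟩ := hsat
  rw [dvd_add_left (dvd_sub dvd_rfl hda.1), dvd_add_right dvd_rfl] at hdvd
  exact hS ⟨⟨⟨dvd_rfl, le_rfl⟩, ⟨dvd_rfl, le_rfl⟩, ⟨hdvd, by omega⟩, hds⟩, by linarith⟩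

theorem IsTopTwo.exists_cons_cons (hs : 2 ≤ Multiset.card s) (hsum : 0 ≤ s.sum)
    (hS : ¬ Saturated s) : ∃ M h t, s = M ::ₘ h ::ₘ t ∧ IsTopTwo M h t := by
  obtain ⟨M, hMs, hM⟩ := Multiset.exists_max_image id
    (Multiset.card_pos.1 (two_pos.trans_le hs))
  simp only [id] at hM
  have hM₀ : 0 < M := by
    by_contra! h₀
    refine hS (saturated_of_forall_eq_zero fun a ha => ?_)
    have := sum_le_of_mem_of_forall_nonpos (fun b hb => (hM b hb).trans h₀) ha
    have := hM a ha
    omega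
  obtain ⟨t, rfl⟩ := Multiset.exists_cons_of_mem hMs
  obtain ⟨a, ha, haM⟩ : ∃ a ∈ t, a < M := by
    by_contra! hge
    have heq : ∀ a ∈ t, a = M := fun a ha =>
      le_antisymm (hM a (Multiset.mem_cons_of_mem ha)) (hge a ha)
    rw [Multiset.card_cons, Nat.succ_le_succ_iff, Nat.succ_le_iff, Multiset.card_pos] at hs
    obtain ⟨a, ha⟩ := Multiset.exists_mem_of_ne_zero hs
    have hle := Multiset.single_le_sum (fun b hb => (heq b hb).symm ▸ hM₀.le) a ha
    refine hS ((saturated_iff_of_mem hM₀ (Multiset.mem_cons_self M t)).2 ⟨fun b hb => ?_, ?_⟩)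
    · obtain rfl : b = M := (Multiset.mem_cons.1 hb).elim id (heq b)
      exact ⟨dvd_rfl, le_rfl⟩
    · rw [Multiset.sum_cons, two_mul]
      linarith [heq a ha]
  have hfilter : t.filter (· < M) ≠ 0 := fun h₀ =>
    Multiset.notMem_zero a (h₀ ▸ Multiset.mem_filter.2 ⟨ha, haM⟩)
  obtain ⟨h, hht, hmax⟩ := Multiset.exists_max_image id hfilter
  rw [Multiset.mem_filter] at hht
  obtain ⟨t, rfl⟩ := Multiset.exists_cons_of_mem hht.1
  refine ⟨M, h, t, rfl, hM₀, hht.2, fun b hb => ?_⟩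
  have hbt := Multiset.mem_cons_of_mem (b := h) hb
  exact (hM b (Multiset.mem_cons_of_mem hbt)).eq_or_lt.imp_right fun hlt =>
    hmax b (Multiset.mem_filter.2 ⟨hbt, hlt⟩)

theorem exists_cons_of_map_eq_cons {Y Z : Type*} {f : Y → Z} {m : Multiset Y} {z : Z}
    {s : Multiset Z} (h : m.map f = z ::ₘ s) : ∃ y t, m = y ::ₘ t ∧ f y = z ∧ t.map f = s := by
  classical
  obtain ⟨y, hy, hyz, hs⟩ := (Multiset.map_eq_cons f m s z).2 h
  exact ⟨y, m.erase y, (Multiset.cons_erase hy).symm, hyz, hs⟩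

theorem exists_cons_cons_isTopTwo {X : Type*} {deg : X → ℤ} {m : Multiset X}
    (hcard : 2 ≤ Multiset.card m) (hsum : 0 ≤ (m.map deg).sum) (hS : ¬ Saturated (m.map deg)) :
    ∃ i k R, m = i ::ₘ k ::ₘ R ∧ IsTopTwo (deg i) (deg k) (R.map deg) := by
  obtain ⟨M, h, t, hm, H⟩ := IsTopTwo.exists_cons_cons (by simpa using hcard) hsum hS
  obtain ⟨i, m, rfl, rfl, hm'⟩ := exists_cons_of_map_eq_cons hm
  obtain ⟨k, R, rfl, rfl, rfl⟩ := exists_cons_of_map_eq_cons hm'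
  exact ⟨i, k, R, rfl, H⟩

end Saturated

section SwappableMagma

variable {X : Type*} [CommMagma X] {deg : X → ℤ} {m : Multiset X} {u : X}

/-- A degree function on a commutative magma, additive on products, such that two factors may be
swapped whenever the degrees in all the products involved are distinct. -/
structure IsSwappable (deg : X → ℤ) : Prop where
  deg_mul : ∀ x y, deg (x * y) = deg x + deg y
  swap : ∀ x y z, deg x ≠ deg y → deg x + deg y ≠ deg z → deg x ≠ deg z →
    deg x + deg z ≠ deg y → x * y * z = x * z * y

/-- `Contracts deg m u`: the element `u` is a product, in some arrangement, of the elements of `m`,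
where only elements of distinct degrees are multiplied. -/
inductive Contracts (deg : X → ℤ) : Multiset X → X → Prop
  | single (x : X) : Contracts deg {x} x
  | mul {x y : X} {m : Multiset X} {u : X} : deg x ≠ deg y →
      Contracts deg (x * y ::ₘ m) u → Contracts deg (x ::ₘ y ::ₘ m) u

theorem IsSwappable.neg (hd : IsSwappable deg) : IsSwappable (fun x => -deg x) where
  deg_mul x y := by rw [hd.deg_mul, neg_add]
  swap x y z h₁ h₂ h₃ h₄ := hd.swap x y z (by grind) (by grind) (by grind) (by grind)

namespace Contracts

theorem neg (h : Contracts deg m u) : Contracts (fun x => -deg x) m u := by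
  induction h with
  | single x => exact .single x
  | mul hxy _ ih => exact .mul (neg_injective.ne hxy) ih

theorem ne_zero (h : Contracts deg m u) : m ≠ 0 := by
  cases h <;> exact Multiset.cons_ne_zero

theorem eq_of_singleton {x : X} (h : Contracts deg {x} u) : u = x := by
  generalize hm : ({x} : Multiset X) = m at h
  cases h with
  | single y => exact (Multiset.singleton_inj.1 hm).symm
  | mul _ _ => simpa using congrArg Multiset.card hm

theorem deg_eq (hd : IsSwappable deg) (h : Contracts deg m u) : deg u = (m.map deg).sum := by
  induction h with
  | single x => simp
  | mul _ _ ih => simpa [hd.deg_mul, add_assoc] using ih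

theorem add {m₁ m₂ : Multiset X} {w : X} (h : Contracts deg m₁ u)
    (hw : Contracts deg (u ::ₘ m₂) w) : Contracts deg (m₁ + m₂) w := by
  induction h with
  | single x => rwa [Multiset.singleton_add]
  | mul hxy _ ih =>
    have := ih hw
    simp only [Multiset.cons_add] at this ⊢
    exact .mul hxy this

theorem mul_add {m₁ m₂ : Multiset X} {v : X} (h₁ : Contracts deg m₁ u)
    (h₂ : Contracts deg m₂ v) (huv : deg u ≠ deg v) : Contracts deg (m₁ + m₂) (u * v) := by
  refine h₁.add ?_
  rw [← Multiset.singleton_add, add_comm]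
  refine h₂.add ?_
  rw [← Multiset.cons_zero, Multiset.cons_swap]
  exact .mul huv (.single _)

theorem exists_partner (hd : IsSwappable deg) (h : Contracts deg m u) {i : X} {m₁ : Multiset X}
    (hm : m = i ::ₘ m₁) (hm₁ : m₁ ≠ 0) :
    ∃ j m₂, m₁ = j ::ₘ m₂ ∧ deg i ≠ deg j ∧ Contracts deg (i * j ::ₘ m₂) u := by
  induction h generalizing i m₁ with
  | single x =>
    exact absurd (congrArg Multiset.card hm) (by simpa [eq_comm] using hm₁)
  | @mul x y m u hxy h ih =>
    rcases Multiset.cons_eq_cons.1 hm with ⟨rfl, rfl⟩ | ⟨-, cs, hcs, rfl⟩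
    · exact ⟨y, m, rfl, hxy, h⟩
    rcases Multiset.cons_eq_cons.1 hcs with ⟨rfl, rfl⟩ | ⟨-, ds, rfl, rfl⟩
    · exact ⟨x, m, rfl, hxy.symm, by rwa [mul_comm]⟩
    obtain ⟨j, m₂, hj, hij, hc⟩ := ih (i := i) (m₁ := x * y ::ₘ ds)
      (Multiset.cons_swap _ _ _) (by simp)
    rcases Multiset.cons_eq_cons.1 hj with ⟨rfl, rfl⟩ | ⟨-, es, rfl, rfl⟩
    · rw [hd.deg_mul] at hij
      -- `i * (x * y)` can be rearranged, as at least one of `x` and `y` can be multiplied by `i`.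
      by_cases h₁ : deg x ≠ deg i ∧ deg x + deg i ≠ deg y
      · refine ⟨x, y ::ₘ ds, rfl, h₁.1.symm, .mul (by rw [hd.deg_mul, add_comm]; exact h₁.2) ?_⟩
        rwa [mul_comm i x, ← hd.swap x y i hxy hij.symm h₁.1 h₁.2, mul_comm _ i]
      · have h₂ : deg y ≠ deg i ∧ deg y + deg i ≠ deg x := by grind
        refine ⟨y, x ::ₘ ds, Multiset.cons_swap _ _ _, h₂.1.symm,
          .mul (by rw [hd.deg_mul, add_comm]; exact h₂.2) ?_⟩
        rwa [mul_comm i y, ← hd.swap y x i hxy.symm (by grind) h₂.1 h₂.2, mul_comm _ i,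
          mul_comm y x]
    · refine ⟨j, x ::ₘ y ::ₘ es, ?_, hij, ?_⟩
      · rw [Multiset.cons_swap y j, Multiset.cons_swap x j]
      · rw [Multiset.cons_swap _ x, Multiset.cons_swap _ y]
        refine .mul hxy ?_
        rwa [Multiset.cons_swap]

theorem deg_ne_of_pair (hd : IsSwappable deg) {x y : X}
    (h : Contracts deg (x ::ₘ y ::ₘ 0) u) : deg x ≠ deg y := by
  obtain ⟨j, m₂, hj, hxj, -⟩ := h.exists_partner hd rfl (Multiset.cons_ne_zero)
  rcases Multiset.cons_eq_cons.1 hj with ⟨rfl, -⟩ | ⟨-, cs, hcs, -⟩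
  · exact hxj
  · exact absurd hcs.symm (Multiset.cons_ne_zero)

theorem sum_lt (hd : IsSwappable deg) (h : Contracts deg m u) {g : ℤ} (hg : 0 ≤ g)
    (hm : ∀ x ∈ m, g ∣ deg x ∧ deg x ≤ g) (hcard : 2 ≤ Multiset.card m) :
    (m.map deg).sum < 2 * g := by
  induction h with
  | single x => simp at hcard
  | @mul x y m u hxy h ih =>
    simp only [Multiset.forall_mem_cons, hd.deg_mul, Multiset.map_cons, Multiset.sum_cons]
      at hm ih ⊢
    rcases m.empty_or_exists_mem with rfl | ⟨z, hz⟩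
    · simp only [Multiset.map_zero, Multiset.sum_zero]
      omega
    · have := ih ⟨⟨dvd_add hm.1.1 hm.2.1.1, add_le_of_dvd_of_le hg hm.1.1 hm.2.1.1 hm.1.2 hm.2.1.2
        hxy⟩, hm.2.2⟩ (by
        rw [Multiset.card_cons]
        exact Nat.succ_le_succ (Multiset.card_pos_iff_exists_mem.2 ⟨z, hz⟩))
      omega

theorem not_saturated (hd : IsSwappable deg) (h : Contracts deg m u)
    (hcard : 2 ≤ Multiset.card m) : ¬ Saturated (m.map deg) := fun ⟨_, hg, hdvd, hge⟩ =>
  (h.sum_lt hd hg (fun _ hx => hdvd _ (Multiset.mem_map_of_mem deg hx)) hcard).not_ge hge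

end Contracts

theorem exists_contracts (hd : IsSwappable deg) {x : X} {R : Multiset X}
    (hsum : 0 ≤ ((x ::ₘ R).map deg).sum) (hR : R = 0 ∨ ¬ Saturated ((x ::ₘ R).map deg)) :
    ∃ u, Contracts deg (x ::ₘ R) u := by
  induction hn : Multiset.card R generalizing x R with
  | zero =>
    rw [Multiset.card_eq_zero.1 hn]
    exact ⟨x, .single x⟩
  | succ n ih =>
    have hS := hR.resolve_left (Multiset.card_pos.1 (by omega))
    obtain ⟨i, k, R', hm, H⟩ := exists_cons_cons_isTopTwo (by simp [hn]) hsum hS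
    have hn' : Multiset.card R' = n := by simpa [hn, eq_comm] using congrArg Multiset.card hm
    rw [hm] at hS hsum ⊢
    simp only [Multiset.map_cons] at hS hsum
    obtain ⟨u, hu⟩ := ih (x := i * k) (R := R') (by simpa [hd.deg_mul, add_assoc] using hsum)
      (or_iff_not_imp_left.2 fun hR' => by
        simpa [hd.deg_mul] using H.not_saturated_add hsum hS (by simpa using hR')) hn'
    exact ⟨u, .mul H.lt.ne' hu⟩

/-- Any two products of the same `n` elements, in the sense of `Contracts`, agree. -/
def UniqueProducts (deg : X → ℤ) (n : ℕ) : Prop :=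
  ∀ m u u', Multiset.card m = n → Contracts deg m u → Contracts deg m u' → u = u'

namespace UniqueProducts

variable {n : ℕ} {i j k l : X} {R : Multiset X}

theorem neg (H : UniqueProducts deg n) : UniqueProducts (fun x => -deg x) n :=
  fun m u u' hm hu hu' => H m u u' hm (by simpa using hu.neg) (by simpa using hu'.neg)

theorem swap (hd : IsSwappable deg) (H : UniqueProducts deg n) (hn : Multiset.card R + 2 = n)
    (hu : 0 ≤ deg u) (hij : deg i ≠ deg j) (hik : deg i ≠ deg k) (hij_k : deg i + deg j ≠ deg k)
    (hik_j : deg i + deg k ≠ deg j)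
    (hR : R = 0 ∨ ¬ Saturated ((deg i + deg j + deg k) ::ₘ R.map deg))
    (h : Contracts deg (i * j ::ₘ k ::ₘ R) u) : Contracts deg (i * k ::ₘ j ::ₘ R) u := by
  rw [h.deg_eq hd] at hu
  obtain ⟨w, hw⟩ := exists_contracts hd (x := i * j * k) (R := R)
    (by simpa [hd.deg_mul, add_assoc] using hu) (by simpa [hd.deg_mul] using hR)
  obtain rfl : u = w := H _ _ _ (by simpa using hn) h (.mul (by rwa [hd.deg_mul]) hw)
  rw [hd.swap i j k hij hij_k hik hik_j] at hw
  exact .mul (by rwa [hd.deg_mul]) hw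

theorem disjoint (hd : IsSwappable deg) (H : UniqueProducts deg n)
    (hn : Multiset.card R + 3 = n) (hu : 0 ≤ deg u) (hij : deg i ≠ deg j) (hkl : deg k ≠ deg l)
    (hS : ¬ Saturated ((deg i + deg j) ::ₘ (deg k + deg l) ::ₘ R.map deg))
    (h : Contracts deg (i * j ::ₘ k ::ₘ l ::ₘ R) u) :
    Contracts deg (k * l ::ₘ i ::ₘ j ::ₘ R) u := by
  rw [h.deg_eq hd] at hu
  obtain ⟨w, hw⟩ := exists_contracts hd (x := i * j) (R := k * l ::ₘ R)
    (by simpa [hd.deg_mul, add_assoc] using hu) (.inr (by simpa [hd.deg_mul] using hS))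
  rw [Multiset.cons_swap] at hw
  obtain rfl : u = w := H _ _ _ (by simpa using hn) h <| by
    rw [Multiset.cons_swap, Multiset.cons_swap (i * j)]
    exact .mul hkl hw
  rw [Multiset.cons_swap] at hw
  rw [Multiset.cons_swap, Multiset.cons_swap (k * l)]
  exact .mul hij hw

theorem swap_of_disjoint (hd : IsSwappable deg) (H : UniqueProducts deg n)
    (hn : Multiset.card R + 3 = n) (hu : 0 ≤ deg u) (hij : deg i ≠ deg j) (hkl : deg k ≠ deg l)
    (hki : deg k ≠ deg i) (hkl_i : deg k + deg l ≠ deg i) (hki_l : deg k + deg i ≠ deg l)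
    (hS₁ : ¬ Saturated ((deg i + deg j) ::ₘ (deg k + deg l) ::ₘ R.map deg))
    (hS₂ : ¬ Saturated ((deg k + deg l + deg i) ::ₘ deg j ::ₘ R.map deg))
    (h : Contracts deg (i * j ::ₘ k ::ₘ l ::ₘ R) u) :
    Contracts deg (i * k ::ₘ j ::ₘ l ::ₘ R) u := by
  have h' := H.disjoint hd hn hu hij hkl hS₁ h
  have := H.swap hd (R := j ::ₘ R) (by simpa using hn) hu hkl hki hkl_i hki_l
    (.inr (by simpa using hS₂)) h'
  rwa [mul_comm k i, Multiset.cons_swap l] at this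

theorem swap_of_intermediate (hd : IsSwappable deg) (H : UniqueProducts deg n)
    (hn : Multiset.card R + 3 = n) (hu : 0 ≤ deg u)
    (hT : IsTopTwo (deg i) (deg k) (deg l ::ₘ R.map deg)) (hi : deg i ∉ R.map deg)
    (hk : 0 < deg k) (hj : deg j < 0) (hl : 0 ≤ deg l) (hlk : deg l < deg k)
    (hij_l : deg i + deg j ≠ deg l)
    (hS : ¬ Saturated ((deg i + deg j + deg l) ::ₘ deg k ::ₘ R.map deg))
    (h : Contracts deg (i * j ::ₘ k ::ₘ l ::ₘ R) u) :
    Contracts deg (i * k ::ₘ j ::ₘ l ::ₘ R) u := by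
  have hik := hT.lt
  have h₁ : Contracts deg (i * l ::ₘ j ::ₘ k ::ₘ R) u :=
    H.swap hd (by simpa using hn) hu (by omega) (by omega) hij_l (by omega)
      (.inr (by simpa using hS)) (by rwa [Multiset.cons_swap l k])
  have h₂ : Contracts deg (i * k ::ₘ l ::ₘ j ::ₘ R) u := by
    refine H.swap hd (by simpa using hn) hu (by omega) hik.ne' (by omega) (by omega) (.inr ?_)
      (by rwa [Multiset.cons_swap k j])
    rw [Multiset.map_cons]
    refine not_saturated_cons_of_forall_lt (by omega) (Multiset.forall_mem_cons.2
      ⟨by omega, fun b hb => ?_⟩)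
    have := (hT.eq_or_le b (Multiset.mem_cons_of_mem hb)).resolve_left fun e => hi (e ▸ hb)
    omega
  rwa [Multiset.cons_swap j l]

theorem swap_of_neg_neg_max (hd : IsSwappable deg) (H : UniqueProducts deg n)
    (hn : Multiset.card R + 3 = n) (hu : 0 ≤ deg u)
    (hT : IsTopTwo (deg i) (deg k) (deg l ::ₘ R.map deg)) (hk : deg k < 0) (hjk : deg j ≤ deg k)
    (hl : deg l = deg i) (h : Contracts deg (i * j ::ₘ k ::ₘ l ::ₘ R) u) :
    Contracts deg (i * k ::ₘ j ::ₘ l ::ₘ R) u := by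
  have hik := hT.lt
  have hS := h.not_saturated hd (by simp)
  simp only [Multiset.map_cons, hd.deg_mul] at hS
  rw [hl] at hT hS
  by_cases hne : deg j ≠ deg k ∨ R.map deg ≠ 0
  · refine H.swap_of_disjoint hd hn hu (by omega) (by omega) (by omega) (by omega) (by omega)
      ?_ ?_ h
    · rw [hl]
      exact hT.not_saturated_disjoint hjk hk hS hne
    · rw [hl]
      exact hT.not_saturated_two_max hjk hk hS
  · push Not at hne
    have hi := hT.pos
    refine H.swap hd (by simpa using hn) hu (by omega) (by omega) (by omega) (by omega)
      (.inr ?_) h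
    rw [Multiset.map_cons, hl, hne.2, saturated_iff_of_mem hT.pos (by simp)]
    simp only [Multiset.sum_cons, Multiset.sum_zero, not_and]
    omega

theorem swap_of_zero_max (hd : IsSwappable deg) (H : UniqueProducts deg n)
    (hn : Multiset.card R + 3 = n) (hu : 0 ≤ deg u) (hi : 0 < deg i) (hk : deg k = 0)
    (hj : deg j ≤ 0) (hl : deg l = deg i) (h : Contracts deg (i * j ::ₘ k ::ₘ l ::ₘ R) u) :
    Contracts deg (i * k ::ₘ j ::ₘ l ::ₘ R) u := by
  have hS := h.not_saturated hd (by simp)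
  simp only [Multiset.map_cons, hd.deg_mul, hk, hl] at hS
  rw [saturated_iff_of_mem hi (by simp)] at hS
  have hS' : ¬ Saturated ((deg i + deg j) ::ₘ deg i ::ₘ R.map deg) := by
    rw [saturated_iff_of_mem hi (by simp)]
    simpa [hi.le] using hS
  by_cases hij : deg i + deg j = 0
  · have h₁ : Contracts deg (j * l ::ₘ i ::ₘ k ::ₘ R) u :=
      H.swap hd (by simpa using hn) hu (by omega) (by omega) (by omega) (by omega)
        (.inr (by
          simpa [hl, hk, hij, add_comm (deg j), Multiset.cons_swap _ (0 : ℤ)] using hS'))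
        (by rwa [Multiset.cons_swap l k, mul_comm])
    exact H.disjoint hd hn hu (by omega) (by omega)
      (by simpa [hl, hk, hij, add_comm (deg j)] using hS') h₁
  · exact H.swap hd (by simpa using hn) hu (by omega) (by omega) (by omega) (by omega)
      (.inr (by simpa [hk, hl] using hS')) h

theorem swap_of_eq_add (hd : IsSwappable deg) (H : UniqueProducts deg n)
    (hn : Multiset.card R + 2 = n) (hu : 0 ≤ deg u)
    (hT : IsTopTwo (deg i) (deg k) (R.map deg)) (hi : deg i ∉ R.map deg) (hk : 0 < deg k)
    (hj : deg j < 0) (hijk : deg i + deg j = deg k)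
    (h : Contracts deg (i * j ::ₘ k ::ₘ R) u) : Contracts deg (i * k ::ₘ j ::ₘ R) u := by
  have hik := hT.lt
  have hle := hT.forall_le hi
  have hS := h.not_saturated hd (by simp)
  simp only [Multiset.map_cons, hd.deg_mul, hijk] at hS
  by_cases hex : ∃ l ∈ R, 0 < deg l ∧ deg l < deg k
  · obtain ⟨l, hl, hl₀, hlk⟩ := hex
    obtain ⟨R, rfl⟩ := Multiset.exists_cons_of_mem hl
    simp only [Multiset.map_cons, Multiset.forall_mem_cons] at hT hle
    rw [Multiset.map_cons, Multiset.mem_cons, not_or] at hi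
    refine H.swap_of_intermediate hd (by simpa using hn) hu hT hi.2 hk hj hl₀.le hlk
      (by omega) (not_saturated_cons_of_forall_lt (by omega) ?_) h
    exact Multiset.forall_mem_cons.2 ⟨by omega, fun b hb => by linarith [hle.2 b hb]⟩
  · have hR : ∀ b ∈ R.map deg, b = deg k ∨ b ≤ 0 := fun b hb => by
      obtain ⟨l, hl, rfl⟩ := Multiset.mem_map.1 hb
      have := hle _ hb
      by_contra! hb'
      exact hex ⟨l, hl, hb'.2, by omega⟩
    obtain ⟨b, hb, hb₀⟩ := exists_nonpos_of_not_saturated hk hR hS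
    obtain ⟨l, hl, rfl⟩ := Multiset.mem_map.1 hb
    obtain ⟨R, rfl⟩ := Multiset.exists_cons_of_mem hl
    simp only [Multiset.map_cons, Multiset.forall_mem_cons] at hR hS
    refine H.swap_of_disjoint hd (by simpa using hn) hu (by omega) (by omega) (by omega)
      (by omega) (by omega) ?_ ?_ h
    · rw [hijk]
      exact not_saturated_cons_add hk hb₀ hS
    · rw [eq_sub_of_add_eq hijk]
      exact not_saturated_cons_cons_of_neg hk hj hb₀ hR.2 hS

theorem swap_of_pos_neg (hd : IsSwappable deg) (H : UniqueProducts deg n)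
    (hn : Multiset.card R + 2 = n) (hu : 0 ≤ deg u)
    (hT : IsTopTwo (deg i) (deg k) (R.map deg)) (hi : deg i ∉ R.map deg) (hR : R.map deg ≠ 0)
    (hk : 0 < deg k) (hj : deg j < 0)
    (h : Contracts deg (i * j ::ₘ k ::ₘ R) u) : Contracts deg (i * k ::ₘ j ::ₘ R) u := by
  have hik := hT.lt
  by_cases hijk : deg i + deg j = deg k
  · exact H.swap_of_eq_add hd hn hu hT hi hk hj hijk h
  by_cases hsat : Saturated ((deg i + deg j + deg k) ::ₘ R.map deg)
  · have hS := h.not_saturated hd (by simp)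
    simp only [Multiset.map_cons, hd.deg_mul] at hS
    obtain ⟨hij, b, hb, hb₀, hbk, hmax⟩ := hT.exists_mem_of_saturated_add hk hi hR hS hsat
    obtain ⟨l, hl, rfl⟩ := Multiset.mem_map.1 hb
    obtain ⟨R, rfl⟩ := Multiset.exists_cons_of_mem hl
    simp only [Multiset.map_cons, Multiset.forall_mem_cons] at hT hmax
    rw [Multiset.map_cons, Multiset.mem_cons, not_or] at hi
    refine H.swap_of_intermediate hd (by simpa using hn) hu hT hi.2 hk hj hb₀ hbk (by omega) ?_ h
    rw [Multiset.cons_swap]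
    exact not_saturated_cons_of_forall_lt hk (Multiset.forall_mem_cons.2
      ⟨by omega, fun c hc => (hmax.2 c hc).trans_lt hbk⟩)
  · exact H.swap hd hn hu (by omega) hik.ne' hijk (by omega) (.inr hsat) h

theorem swap_of_forall_le (hd : IsSwappable deg) (H : UniqueProducts deg n)
    (hn : Multiset.card R + 2 = n) (hu : 0 ≤ deg u) (hR : R ≠ 0)
    (hT : IsTopTwo (deg i) (deg k) (R.map deg)) (hi : deg i ∉ R.map deg) (hjk : deg j ≤ deg k)
    (hj : deg k ≤ 0 ∨ deg j < 0) (h : Contracts deg (i * j ::ₘ k ::ₘ R) u) :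
    Contracts deg (i * k ::ₘ j ::ₘ R) u := by
  have hik := hT.lt
  have hi₀ := hT.pos
  have hR' : R.map deg ≠ 0 := by simpa using hR
  rcases le_or_gt (deg k) 0 with hk | hk
  · have hS := h.not_saturated hd (by simp)
    have hsum := h.deg_eq hd ▸ hu
    simp only [Multiset.map_cons, hd.deg_mul] at hS hsum
    obtain ⟨hne, hS'⟩ := ne_and_not_saturated_add_of_nonpos hk (hT.forall_le hi) hR' hsum hS
    exact H.swap hd hn hu (by omega) (by omega) hne (by omega) (.inr hS') h
  · exact H.swap_of_pos_neg hd hn hu hT hi hR' hk (by omega) h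

theorem swap_of_max_mem (hd : IsSwappable deg) (H : UniqueProducts deg n)
    (hn : Multiset.card R + 3 = n) (hu : 0 ≤ deg u)
    (hT : IsTopTwo (deg i) (deg k) (deg l ::ₘ R.map deg)) (hl : deg l = deg i)
    (hjk : deg j ≤ deg k) (hj : deg k ≤ 0 ∨ deg j < 0)
    (h : Contracts deg (i * j ::ₘ k ::ₘ l ::ₘ R) u) :
    Contracts deg (i * k ::ₘ j ::ₘ l ::ₘ R) u := by
  have hik := hT.lt
  have hi₀ := hT.pos
  rcases lt_trichotomy (deg k) 0 with hk | hk | hk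
  · exact H.swap_of_neg_neg_max hd hn hu hT hk hjk hl h
  · exact H.swap_of_zero_max hd hn hu hi₀ hk (by omega) hl h
  · have hle := hT.le
    rw [Multiset.forall_mem_cons] at hle
    refine H.swap_of_disjoint hd hn hu (by omega) (by omega) (by omega) (by omega) (by omega)
      ?_ ?_ h
    · rw [Multiset.cons_swap]
      exact not_saturated_cons_of_forall_lt (by omega) (Multiset.forall_mem_cons.2
        ⟨by omega, fun b hb => by linarith [hle.2 b hb]⟩)
    · exact not_saturated_cons_of_forall_lt (by omega) (Multiset.forall_mem_cons.2
        ⟨by omega, fun b hb => by linarith [hle.2 b hb]⟩)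

theorem swap_of_isTopTwo (hd : IsSwappable deg) (H : UniqueProducts deg n)
    (hn : Multiset.card R + 2 = n) (hu : 0 ≤ deg u)
    (hT : IsTopTwo (deg i) (deg k) (deg j ::ₘ R.map deg)) (hij : deg i ≠ deg j)
    (h : Contracts deg (i * j ::ₘ k ::ₘ R) u) : Contracts deg (i * k ::ₘ j ::ₘ R) u := by
  have hik := hT.lt
  have hi₀ := hT.pos
  have hjk : deg j ≤ deg k := (hT.eq_or_le _ (by simp)).resolve_left hij.symm
  have hT' : IsTopTwo (deg i) (deg k) (R.map deg) :=
    ⟨hi₀, hik, fun b hb => hT.eq_or_le b (Multiset.mem_cons_of_mem hb)⟩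
  rcases eq_or_ne R 0 with rfl | hR
  · have hij_k := h.deg_ne_of_pair hd
    rw [hd.deg_mul] at hij_k
    exact H.swap hd hn hu hij hik.ne' hij_k (by omega) (.inl rfl) h
  by_cases hj : deg k ≤ 0 ∨ deg j < 0
  · by_cases hi : deg i ∈ R.map deg
    · obtain ⟨l, hl, hli⟩ := Multiset.mem_map.1 hi
      obtain ⟨R, rfl⟩ := Multiset.exists_cons_of_mem hl
      rw [Multiset.map_cons] at hT'
      exact H.swap_of_max_mem hd (by simpa using hn) hu hT' hli hjk hj h
    · exact H.swap_of_forall_le hd hn hu hR hT' hi hjk hj h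
  · push Not at hj
    refine H.swap hd hn hu hij hik.ne' (by omega) (by omega) (.inr ?_) h
    exact not_saturated_cons_of_forall_lt (by omega) fun b hb => by linarith [hT'.le b hb]

theorem eq_of_nonneg (hd : IsSwappable deg) (H : UniqueProducts deg n) {u' : X} (hu₀ : 0 ≤ deg u)
    (hn : Multiset.card m = n + 1) (hu : Contracts deg m u) (hu' : Contracts deg m u') :
    u = u' := by
  rcases n.eq_zero_or_pos with rfl | hn₀
  · obtain ⟨x, rfl⟩ := Multiset.card_eq_one.1 hn
    exact hu.eq_of_singleton.trans hu'.eq_of_singleton.symm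
  have hm : 2 ≤ Multiset.card m := by omega
  obtain ⟨i, k, R, rfl, hT⟩ :=
    exists_cons_cons_isTopTwo hm (hu.deg_eq hd ▸ hu₀) (hu.not_saturated hd hm)
  have top : ∀ w, 0 ≤ deg w → Contracts deg (i ::ₘ k ::ₘ R) w → Contracts deg (i * k ::ₘ R) w := by
    intro w hw₀ hw
    obtain ⟨j, t, hj, hij, hw⟩ := hw.exists_partner hd rfl Multiset.cons_ne_zero
    rcases Multiset.cons_eq_cons.1 hj with ⟨rfl, rfl⟩ | ⟨-, t, rfl, rfl⟩
    · exact hw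
    · exact H.swap_of_isTopTwo hd (by simpa using hn) hw₀ (by rwa [Multiset.map_cons] at hT) hij hw
  exact H _ _ _ (by simpa using hn) (top u hu₀ hu)
    (top u' (by rwa [hu'.deg_eq hd, ← hu.deg_eq hd]) hu')

end UniqueProducts

theorem uniqueProducts (hd : IsSwappable deg) (n : ℕ) : UniqueProducts deg n := by
  induction n generalizing deg with
  | zero => exact fun m u u' hm hu => absurd (Multiset.card_eq_zero.1 hm) hu.ne_zero
  | succ n ih =>
    intro m u u' hm hu hu'
    rcases le_total 0 (deg u) with hu₀ | hu₀
    · exact (ih hd).eq_of_nonneg hd hu₀ hm hu hu'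
    · exact (ih hd.neg).eq_of_nonneg hd.neg (neg_nonneg.2 hu₀) hm hu.neg hu'.neg

theorem Contracts.unique (hd : IsSwappable deg) {u' : X} (hu : Contracts deg m u)
    (hu' : Contracts deg m u') : u = u' :=
  uniqueProducts hd _ m u u' rfl hu hu'

end SwappableMagma

section Span

variable {R L : Type*} [CommRing R] [LieRing L] [LieAlgebra R L]

theorem lie_mem_of_mem_span {S T : Set L} {P : Submodule R L}
    (h : ∀ x ∈ S, ∀ y ∈ T, ⁅x, y⁆ ∈ P) {x y : L} (hx : x ∈ Submodule.span R S)
    (hy : y ∈ Submodule.span R T) : ⁅x, y⁆ ∈ P :=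
  LinearMap.BilinMap.apply_apply_mem_of_mem_span P S T
    (LieModule.toEnd R L L : L →ₗ[R] L →ₗ[R] L) h x y hx hy

theorem span_eq_top_of_forall_of_mem {V : Type*} {S : Set (FreeLieAlgebra R V)}
    (hof : ∀ v, FreeLieAlgebra.of R v ∈ S) (hlie : ∀ x ∈ S, ∀ y ∈ S, ⁅x, y⁆ ∈ S) :
    Submodule.span R S = ⊤ := by
  let A : LieSubalgebra R (FreeLieAlgebra R V) :=
    { Submodule.span R S with
      lie_mem' := lie_mem_of_mem_span fun x hx y hy => Submodule.subset_span (hlie x hx y hy) }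
  let ψ : FreeLieAlgebra R V →ₗ⁅R⁆ A :=
    FreeLieAlgebra.lift R fun v => ⟨FreeLieAlgebra.of R v, Submodule.subset_span (hof v)⟩
  have hψ : A.incl.comp ψ = LieHom.id :=
    FreeLieAlgebra.hom_ext fun v => by simp [ψ, FreeLieAlgebra.lift_of_apply]
  refine eq_top_iff.2 fun f _ => ?_
  rw [← LieHom.id_apply (R := R) f, ← hψ]
  exact (ψ f).2

end Span

/-- A family of subspaces of a Lie algebra, compatible with the bracket, whose elements satisfy the
two families of identities of the theorem. -/
structure WittFamily (K Q : Type*) [Field K] [LieRing Q] [LieAlgebra K Q] where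
  component : ℤ → Submodule K Q
  lie_mem : ∀ {a b : ℤ} {u v : Q}, u ∈ component a → v ∈ component b → ⁅u, v⁆ ∈ component (a + b)
  lie_eq_zero : ∀ {a : ℤ} {u v : Q}, u ∈ component a → v ∈ component a → ⁅u, v⁆ = 0
  lie_swap : ∀ {a b c : ℤ} {u v w : Q}, u ∈ component a → v ∈ component b → w ∈ component c →
    (((c - a) * (b - c - a) : ℤ) : K) • ⁅⁅u, v⁆, w⁆ =
      (((b - a) * (c - b - a) : ℤ) : K) • ⁅⁅u, w⁆, v⁆

namespace WittFamily

variable {K Q : Type*} [Field K] [LieRing Q] [LieAlgebra K Q]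

/-- A homogeneous element together with its degree, so that `0` has all degrees. -/
@[ext]
structure Homogeneous (𝒢 : WittFamily K Q) where
  deg : ℤ
  el : Q
  mem : el ∈ 𝒢.component deg

variable (𝒢 : WittFamily K Q)

/-- The product is the bracket divided by the coefficient `b - a` of `[e_a, e_b]`; it is `0` when
the degrees agree, as `0⁻¹ = 0`. -/
noncomputable instance : CommMagma 𝒢.Homogeneous where
  mul x y := ⟨x.deg + y.deg, ((y.deg - x.deg : ℤ) : K)⁻¹ • ⁅x.el, y.el⁆,
    Submodule.smul_mem _ _ (𝒢.lie_mem x.mem y.mem)⟩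
  mul_comm x y := by
    refine Homogeneous.ext (add_comm _ _) ?_
    change ((y.deg - x.deg : ℤ) : K)⁻¹ • ⁅x.el, y.el⁆ = ((x.deg - y.deg : ℤ) : K)⁻¹ • ⁅y.el, x.el⁆
    rw [← lie_skew x.el, ← neg_sub y.deg, Int.cast_neg, inv_neg, smul_neg, neg_smul]

theorem deg_mul (x y : 𝒢.Homogeneous) : (x * y).deg = x.deg + y.deg := rfl

theorem el_mul (x y : 𝒢.Homogeneous) :
    (x * y).el = ((y.deg - x.deg : ℤ) : K)⁻¹ • ⁅x.el, y.el⁆ := rfl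

theorem el_mul_mul (x y z : 𝒢.Homogeneous) : (x * y * z).el =
    (((y.deg - x.deg) * (z.deg - y.deg - x.deg) : ℤ) : K)⁻¹ • ⁅⁅x.el, y.el⁆, z.el⁆ := by
  rw [el_mul, el_mul, deg_mul, smul_lie, smul_smul, Int.cast_mul, mul_inv_rev, sub_sub,
    add_comm y.deg]

theorem isSwappable [CharZero K] : IsSwappable (Homogeneous.deg (𝒢 := 𝒢)) where
  deg_mul := 𝒢.deg_mul
  swap x y z hxy hxy_z hxz hxz_y := by
    have hβ : (((y.deg - x.deg) * (z.deg - y.deg - x.deg) : ℤ) : K) ≠ 0 :=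
      Int.cast_ne_zero.2 (mul_ne_zero (by omega) (by omega))
    have hα : (((z.deg - x.deg) * (y.deg - z.deg - x.deg) : ℤ) : K) ≠ 0 :=
      Int.cast_ne_zero.2 (mul_ne_zero (by omega) (by omega))
    refine Homogeneous.ext (add_right_comm _ _ _) ?_
    rw [el_mul_mul, el_mul_mul, inv_smul_eq_iff₀ hβ, smul_comm, eq_inv_smul_iff₀ hα]
    exact 𝒢.lie_swap x.mem y.mem z.mem

end WittFamily

/-- `IsMonomial m c f`: the element `f` is a commutator in the variables listed in `m`, and `c` is
the coefficient of its value in `U₁` under `x_i^g ↦ e_g`. -/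
inductive IsMonomial {K : Type*} [Field K] : Multiset (ℤ × ℕ) → K → FreeGradedLie K ℤ → Prop
  | var (v : ℤ × ℕ) : IsMonomial {v} 1 (FreeLieAlgebra.of K v)
  | lie {m₁ m₂ : Multiset (ℤ × ℕ)} {c₁ c₂ : K} {f₁ f₂ : FreeGradedLie K ℤ} :
      IsMonomial m₁ c₁ f₁ → IsMonomial m₂ c₂ f₂ →
      IsMonomial (m₁ + m₂)
        ((((m₂.map Prod.fst).sum - (m₁.map Prod.fst).sum : ℤ) : K) * (c₁ * c₂)) ⁅f₁, f₂⁆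

theorem span_isMonomial (K : Type*) [Field K] :
    Submodule.span K {f : FreeGradedLie K ℤ | ∃ m c, IsMonomial m c f} = ⊤ :=
  span_eq_top_of_forall_of_mem (fun v => ⟨_, _, .var v⟩)
    fun _ ⟨_, _, hx⟩ _ ⟨_, _, hy⟩ => ⟨_, _, hx.lie hy⟩

section Image

variable {K Q : Type*} [Field K] [CharZero K] [LieRing Q] [LieAlgebra K Q] (𝒢 : WittFamily K Q)
  (a : ∀ v : ℤ × ℕ, 𝒢.component v.1)

/-- The substitution `a` as a map to homogeneous elements. -/
def WittFamily.homogeneous (v : ℤ × ℕ) : 𝒢.Homogeneous :=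
  ⟨v.1, a v, (a v).2⟩

theorem IsMonomial.lift_eq_smul {m : Multiset (ℤ × ℕ)} {c : K} {f : FreeGradedLie K ℤ}
    (h : IsMonomial m c f) : c = 0 ∧ FreeLieAlgebra.lift K (fun v => (a v : Q)) f = 0 ∨
      c ≠ 0 ∧ ∃ u, Contracts WittFamily.Homogeneous.deg (m.map (𝒢.homogeneous a)) u ∧
        FreeLieAlgebra.lift K (fun v => (a v : Q)) f = c • u.el := by
  induction h with
  | var v =>
    refine .inr ⟨one_ne_zero, 𝒢.homogeneous a v, .single _, ?_⟩
    rw [FreeLieAlgebra.lift_of_apply, one_smul, WittFamily.homogeneous]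
  | @lie m₁ m₂ c₁ c₂ f₁ f₂ _ _ ih₁ ih₂ =>
    rcases ih₁ with ⟨rfl, h₁⟩ | ⟨hc₁, u₁, hu₁, h₁⟩
    · exact .inl (by simp [h₁])
    rcases ih₂ with ⟨rfl, h₂⟩ | ⟨hc₂, u₂, hu₂, h₂⟩
    · exact .inl (by simp [h₂])
    have d₁ : u₁.deg = (m₁.map Prod.fst).sum := by
      rw [hu₁.deg_eq 𝒢.isSwappable, Multiset.map_map]
      rfl
    have d₂ : u₂.deg = (m₂.map Prod.fst).sum := by
      rw [hu₂.deg_eq 𝒢.isSwappable, Multiset.map_map]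
      rfl
    rw [← d₁, ← d₂, LieHom.map_lie, h₁, h₂, smul_lie, lie_smul, smul_smul]
    by_cases hd : u₁.deg = u₂.deg
    · exact .inl ⟨by simp [hd], by rw [𝒢.lie_eq_zero u₁.mem (hd ▸ u₂.mem), smul_zero]⟩
    · have hne : ((u₂.deg - u₁.deg : ℤ) : K) ≠ 0 := Int.cast_ne_zero.2 (sub_ne_zero.2 (Ne.symm hd))
      refine .inr ⟨mul_ne_zero hne (mul_ne_zero hc₁ hc₂), u₁ * u₂, ?_, ?_⟩
      · rw [Multiset.map_add]
        exact hu₁.mul_add hu₂ hd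
      · rw [WittFamily.el_mul, smul_smul, mul_right_comm, mul_inv_cancel₀ hne, one_mul]

theorem exists_forall_isMonomial_lift_eq_smul : ∃ N : Multiset (ℤ × ℕ) → Q, ∀ m c f,
    IsMonomial m c f → FreeLieAlgebra.lift K (fun v => (a v : Q)) f = c • N m := by
  classical
  refine ⟨fun m => if h : ∃ u, Contracts WittFamily.Homogeneous.deg (m.map (𝒢.homogeneous a)) u
    then h.choose.el else 0, fun m c f hf => ?_⟩
  rcases hf.lift_eq_smul 𝒢 a with ⟨rfl, h⟩ | ⟨-, u, hu, h⟩
  · rw [h, zero_smul]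
  · have hex : ∃ u, Contracts WittFamily.Homogeneous.deg (m.map (𝒢.homogeneous a)) u := ⟨u, hu⟩
    simp only [dif_pos hex, h, hu.unique 𝒢.isSwappable hex.choose_spec]

end Image

namespace U₁

variable {K : Type*} [Field K]

theorem ddt_T (n : ℤ) : ddt K (LaurentPolynomial.T n) = (n : K) • LaurentPolynomial.T (n - 1) := by
  change ddtLinear K _ = _
  simpa [LaurentPolynomial.smul_eq_C_mul] using ddtLinear_C_mul_T K 1 n

theorem e_apply (n : ℤ) (p : K[T;T⁻¹]) : e K n p = LaurentPolynomial.T (n + 1) * ddt K p := rfl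

theorem lie_e (a b : ℤ) : ⁅e K a, e K b⁆ = ((b - a : ℤ) : K) • e K (a + b) := by
  refine Derivation.ext fun p => ?_
  have h₁ : (LaurentPolynomial.T (a + 1) * LaurentPolynomial.T b : K[T;T⁻¹]) =
      LaurentPolynomial.T (a + b + 1) := by
    rw [← LaurentPolynomial.T_add, add_right_comm]
  have h₂ : (LaurentPolynomial.T (b + 1) * LaurentPolynomial.T a : K[T;T⁻¹]) =
      LaurentPolynomial.T (a + b + 1) := by
    rw [← LaurentPolynomial.T_add, add_right_comm, add_comm b]
  simp only [Derivation.commutator_apply, Derivation.smul_apply, e_apply, Derivation.leibniz,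
    ddt_T, smul_eq_mul, add_sub_cancel_right, LaurentPolynomial.smul_eq_C_mul, Int.cast_add,
    Int.cast_sub, Int.cast_one, map_sub, map_add, map_one]
  linear_combination (LaurentPolynomial.C (b : K) + 1) * ddt K p * h₁ -
    (LaurentPolynomial.C (a : K) + 1) * ddt K p * h₂

theorem smul_lie_smul (r s : K) (D E : U₁ K) : ⁅r • D, s • E⁆ = (r * s) • ⁅D, E⁆ :=
  (smul_lie r D (s • E)).trans ((congrArg (r • ·) (lie_smul s D E)).trans (smul_smul r s ⁅D, E⁆))

theorem lie_mem_component {a b : ℤ} {u v : U₁ K} (hu : u ∈ component K a)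
    (hv : v ∈ component K b) : ⁅u, v⁆ ∈ component K (a + b) := by
  refine lie_mem_of_mem_span ?_ hu hv
  rintro _ rfl _ rfl
  rw [lie_e]
  exact Submodule.smul_mem _ _ (Submodule.mem_span_singleton_self _)

/-- The value of `p` at `t = 1`, for the derivation `p d/dt`. -/
noncomputable def coeffAtOne (K : Type*) [Field K] : U₁ K →ₗ[K] K where
  toFun D := LaurentPolynomial.eval₂ (RingHom.id K) 1 (D (LaurentPolynomial.T 1))
  map_add' D E := by simp
  map_smul' c D := by simp [LaurentPolynomial.smul_eq_C_mul]

theorem coeffAtOne_e (n : ℤ) : coeffAtOne K (e K n) = 1 := by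
  simp [coeffAtOne, e_apply, ddt_T]

end U₁

section GenericValue

variable {K : Type*} [Field K]

theorem IsMonomial.lift_smul_e {m : Multiset (ℤ × ℕ)} {c : K} {f : FreeGradedLie K ℤ}
    (h : IsMonomial m c f) (r : ℤ × ℕ → K) :
    FreeLieAlgebra.lift K (fun v => r v • U₁.e K v.1) f =
      (c * (m.map r).prod) • U₁.e K (m.map Prod.fst).sum := by
  induction h with
  | var v => simp [FreeLieAlgebra.lift_of_apply]
  | lie _ _ ih₁ ih₂ =>
    rw [LieHom.map_lie, ih₁, ih₂, U₁.smul_lie_smul, U₁.lie_e, smul_smul,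
      Multiset.map_add, Multiset.map_add, Multiset.prod_add, Multiset.sum_add]
    congr 1
    ring

/-- The scalars `r v` keep monomials with different variables apart, so that a single coefficient of
the generic value of `f` in `U₁` determines the image of `f` in `Q`. -/
theorem exists_mvPolynomial {Q : Type*} [AddCommGroup Q] [Module K Q]
    (φ : FreeGradedLie K ℤ →ₗ[K] Q) {N : Multiset (ℤ × ℕ) → Q}
    (hN : ∀ m c f, IsMonomial m c f → φ f = c • N m) (f : FreeGradedLie K ℤ) :
    ∃ p : MvPolynomial (ℤ × ℕ) K,
      φ f = (MvPolynomial.basisMonomials (ℤ × ℕ) K).constr K (fun d => N (Finsupp.toMultiset d)) p ∧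
      ∀ r : ℤ × ℕ → K, U₁.coeffAtOne K (FreeLieAlgebra.lift K (fun v => r v • U₁.e K v.1) f) =
        MvPolynomial.eval r p := by
  classical
  have hf : f ∈ Submodule.span K {f : FreeGradedLie K ℤ | ∃ m c, IsMonomial m c f} :=
    span_isMonomial K ▸ Submodule.mem_top
  induction hf using Submodule.span_induction with
  | zero => exact ⟨0, by simp, by simp⟩
  | add f₁ f₂ _ _ h₁ h₂ =>
    obtain ⟨p₁, h₁, h₁'⟩ := h₁
    obtain ⟨p₂, h₂, h₂'⟩ := h₂
    exact ⟨p₁ + p₂, by rw [map_add, map_add, h₁, h₂], fun r => by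
      rw [map_add, map_add, map_add, h₁', h₂']⟩
  | smul c f _ h =>
    obtain ⟨p, h, h'⟩ := h
    exact ⟨c • p, by rw [map_smul, map_smul, h], fun r => by
      rw [map_smul, map_smul, h', MvPolynomial.smul_eval, smul_eq_mul]⟩
  | mem f hf =>
    obtain ⟨m, c, hf⟩ := hf
    refine ⟨c • MvPolynomial.basisMonomials _ K (Multiset.toFinsupp m), ?_, fun r => ?_⟩
    · rw [map_smul, Module.Basis.constr_basis, Multiset.toFinsupp_toMultiset, hN m c f hf]
    · rw [hf.lift_smul_e, map_smul, U₁.coeffAtOne_e, Finset.prod_multiset_map_count]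
      simp [MvPolynomial.eval_monomial, Finsupp.prod, MvPolynomial.smul_eval]

theorem FreeGradedLie.IsGradedIdentity.lift_eq_zero [CharZero K] {Q : Type*} [LieRing Q]
    [LieAlgebra K Q] {f : FreeGradedLie K ℤ} (hf : IsGradedIdentity (U₁.component K) f)
    (𝒢 : WittFamily K Q) (a : ∀ v : ℤ × ℕ, 𝒢.component v.1) :
    FreeLieAlgebra.lift K (fun v => (a v : Q)) f = 0 := by
  obtain ⟨N, hN⟩ := exists_forall_isMonomial_lift_eq_smul 𝒢 a
  obtain ⟨p, hp, hp_eval⟩ := exists_mvPolynomial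
    (FreeLieAlgebra.lift K (fun v => (a v : Q)) : FreeGradedLie K ℤ →ₗ[K] Q) hN f
  have hp₀ : p = 0 := MvPolynomial.funext fun r => by
    rw [← hp_eval r, map_zero, hf, map_zero]
    exact fun g i => Submodule.smul_mem _ _ (Submodule.mem_span_singleton_self _)
  rw [hp₀, map_zero] at hp
  exact hp

end GenericValue

namespace FreeGradedLie

variable {K : Type*} [Field K]

section TIdeal

variable {G : Type*} [AddCommGroup G] {S : Set (FreeGradedLie K G)}

theorem x_mem_component (i : ℕ) (g : G) : x K i g ∈ component K g :=
  Submodule.subset_span (.var i g)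

theorem lie_mem_component {g h : G} {u v : FreeGradedLie K G} (hu : u ∈ component K g)
    (hv : v ∈ component K h) : ⁅u, v⁆ ∈ component K (g + h) :=
  lie_mem_of_mem_span (fun _ hx _ hy => Submodule.subset_span (.lie hx hy)) hu hv

theorem lift_mem {L : Type*} [LieRing L] [LieAlgebra K L] {𝒜 : G → Submodule K L}
    (hlie : ∀ {g h u v}, u ∈ 𝒜 g → v ∈ 𝒜 h → ⁅u, v⁆ ∈ 𝒜 (g + h))
    {a : G × ℕ → L} (ha : ∀ g i, a (g, i) ∈ 𝒜 g) {g : G} {f : FreeGradedLie K G}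
    (hf : f ∈ component K g) : FreeLieAlgebra.lift K a f ∈ 𝒜 g := by
  suffices component K g ≤ (𝒜 g).comap (FreeLieAlgebra.lift K a : _ →ₗ[K] L) from this hf
  refine Submodule.span_le.2 fun m (hm : IsCommutator g m) => ?_
  change FreeLieAlgebra.lift K a m ∈ 𝒜 g
  clear hf
  induction hm with
  | var i g =>
    rw [x, FreeLieAlgebra.lift_of_apply]
    exact ha g i
  | lie _ _ ih₁ ih₂ =>
    rw [LieHom.map_lie]
    exact hlie ih₁ ih₂

theorem mem_tIdealSpan {f : FreeGradedLie K G} :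
    f ∈ tIdealSpan S ↔ ∀ I, IsTIdeal I ∧ S ⊆ I → f ∈ I := by
  rw [tIdealSpan, ← SetLike.mem_coe, LieSubmodule.coe_sInf]
  simp

theorem lift_mem_tIdealSpan {f : FreeGradedLie K G} (hf : f ∈ S) {a : G × ℕ → FreeGradedLie K G}
    (ha : ∀ g i, a (g, i) ∈ component K g) : FreeLieAlgebra.lift K a f ∈ tIdealSpan S :=
  mem_tIdealSpan.2 fun _ hI => hI.1 _ (fun _ _ => lift_mem lie_mem_component ha) f (hI.2 hf)

/-- The ideal of graded identities. -/
def identityIdeal {L : Type*} [LieRing L] [LieAlgebra K L] (𝒜 : G → Submodule K L) :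
    LieIdeal K (FreeGradedLie K G) where
  carrier := {f | IsGradedIdentity 𝒜 f}
  add_mem' hf hg a ha := by rw [map_add, hf a ha, hg a ha, add_zero]
  zero_mem' a _ := map_zero _
  smul_mem' c f hf a ha := by rw [map_smul, hf a ha, smul_zero]
  lie_mem hf a ha := by rw [LieHom.map_lie, hf a ha, lie_zero]

theorem isTIdeal_identityIdeal {L : Type*} [LieRing L] [LieAlgebra K L] {𝒜 : G → Submodule K L}
    (hlie : ∀ {g h u v}, u ∈ 𝒜 g → v ∈ 𝒜 h → ⁅u, v⁆ ∈ 𝒜 (g + h)) :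
    IsTIdeal (identityIdeal 𝒜) := by
  intro φ hφ f hf a ha
  have hcomp : (FreeLieAlgebra.lift K a).comp φ =
      FreeLieAlgebra.lift K fun v => FreeLieAlgebra.lift K a (φ (FreeLieAlgebra.of K v)) :=
    FreeLieAlgebra.hom_ext fun v => by rw [FreeLieAlgebra.lift_of_apply, LieHom.comp_apply]
  rw [← LieHom.comp_apply, hcomp]
  exact hf _ fun g i => lift_mem hlie ha (hφ g _ (x_mem_component i g))

theorem exists_substitution {a b c : G} {u v w : FreeGradedLie K G} (hu : u ∈ component K a)
    (hv : v ∈ component K b) (hw : w ∈ component K c) :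
    ∃ s : G × ℕ → FreeGradedLie K G, (∀ g i, s (g, i) ∈ component K g) ∧
      s (a, 1) = u ∧ s (b, 2) = v ∧ s (c, 3) = w := by
  classical
  refine ⟨fun p => if p = (a, 1) then u else if p = (b, 2) then v else if p = (c, 3) then w else 0,
    fun g i => ?_, by simp, by simp, by simp⟩
  dsimp only
  split_ifs with h₁ h₂ h₃
  · exact (Prod.mk.inj h₁).1 ▸ hu
  · exact (Prod.mk.inj h₂).1 ▸ hv
  · exact (Prod.mk.inj h₃).1 ▸ hw
  · exact zero_mem _

end TIdeal

/-- The two families of graded identities of `U₁` that form the basis. -/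
def basicIdentities (K : Type*) [Field K] : Set (FreeGradedLie K ℤ) :=
  {f | ∃ i : ℤ, f = ⁅x K 1 i, x K 2 i⁆} ∪
  {f | ∃ a b c : ℤ, f = (((c - a) * (b - c - a) : ℤ) : K) • ⁅⁅x K 1 a, x K 2 b⁆, x K 3 c⁆ -
    (((b - a) * (c - b - a) : ℤ) : K) • ⁅⁅x K 1 a, x K 3 c⁆, x K 2 b⁆}

theorem basicIdentities_subset_identityIdeal :
    basicIdentities K ⊆ identityIdeal (U₁.component K) := by
  rintro f (⟨i, rfl⟩ | ⟨a, b, c, rfl⟩) s hs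
  · obtain ⟨r₁, h₁⟩ := Submodule.mem_span_singleton.1 (hs i 1)
    obtain ⟨r₂, h₂⟩ := Submodule.mem_span_singleton.1 (hs i 2)
    simp only [x, LieHom.map_lie, FreeLieAlgebra.lift_of_apply, ← h₁, ← h₂]
    rw [U₁.smul_lie_smul, lie_self, smul_zero]
  · obtain ⟨r₁, h₁⟩ := Submodule.mem_span_singleton.1 (hs a 1)
    obtain ⟨r₂, h₂⟩ := Submodule.mem_span_singleton.1 (hs b 2)
    obtain ⟨r₃, h₃⟩ := Submodule.mem_span_singleton.1 (hs c 3)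
    simp only [x, map_sub, map_smul, LieHom.map_lie, FreeLieAlgebra.lift_of_apply, ← h₁, ← h₂,
      ← h₃, U₁.smul_lie_smul, U₁.lie_e, smul_smul]
    rw [add_right_comm a c b, sub_eq_zero]
    congr 1
    push_cast
    ring

theorem isGradedIdentity_of_mem_tIdealSpan {f : FreeGradedLie K ℤ}
    (hf : f ∈ tIdealSpan (basicIdentities K)) : IsGradedIdentity (U₁.component K) f :=
  mem_tIdealSpan.1 hf (identityIdeal (U₁.component K))
    ⟨isTIdeal_identityIdeal U₁.lie_mem_component, basicIdentities_subset_identityIdeal⟩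

theorem lie_mem_tIdealSpan {a : ℤ} {u v : FreeGradedLie K ℤ} (hu : u ∈ component K a)
    (hv : v ∈ component K a) : ⁅u, v⁆ ∈ tIdealSpan (basicIdentities K) := by
  obtain ⟨s, hs, rfl, rfl, -⟩ := exists_substitution hu hv (x_mem_component 0 0)
  simpa only [LieHom.map_lie, x, FreeLieAlgebra.lift_of_apply] using
    lift_mem_tIdealSpan (S := basicIdentities K) (.inl ⟨a, rfl⟩) hs

theorem smul_lie_sub_smul_lie_mem_tIdealSpan {a b c : ℤ} {u v w : FreeGradedLie K ℤ}
    (hu : u ∈ component K a) (hv : v ∈ component K b) (hw : w ∈ component K c) :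
    (((c - a) * (b - c - a) : ℤ) : K) • ⁅⁅u, v⁆, w⁆ -
      (((b - a) * (c - b - a) : ℤ) : K) • ⁅⁅u, w⁆, v⁆ ∈ tIdealSpan (basicIdentities K) := by
  obtain ⟨s, hs, rfl, rfl, rfl⟩ := exists_substitution hu hv hw
  simpa only [map_sub, map_smul, LieHom.map_lie, x, FreeLieAlgebra.lift_of_apply] using
    lift_mem_tIdealSpan (S := basicIdentities K) (.inr ⟨a, b, c, rfl⟩) hs

/-- The projection onto the quotient by the ideal generated by the basic identities. -/
noncomputable def toRelativelyFree (K : Type*) [Field K] :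
    FreeGradedLie K ℤ →ₗ⁅K⁆ FreeGradedLie K ℤ ⧸ tIdealSpan (basicIdentities K) :=
  { (tIdealSpan (basicIdentities K)).toSubmodule.mkQ with map_lie' := rfl }

theorem toRelativelyFree_eq_zero {f : FreeGradedLie K ℤ} :
    toRelativelyFree K f = 0 ↔ f ∈ tIdealSpan (basicIdentities K) :=
  Submodule.Quotient.mk_eq_zero _

/-- The images of the homogeneous components in the quotient by the ideal generated by the basic
identities. -/
noncomputable def relativelyFreeFamily (K : Type*) [Field K] :
    WittFamily K (FreeGradedLie K ℤ ⧸ tIdealSpan (basicIdentities K)) where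
  component a := (component K a).map (toRelativelyFree K : FreeGradedLie K ℤ →ₗ[K] _)
  lie_mem := by
    rintro a b _ _ ⟨u, hu, rfl⟩ ⟨v, hv, rfl⟩
    exact ⟨⁅u, v⁆, lie_mem_component hu hv, LieHom.map_lie _ u v⟩
  lie_eq_zero := by
    rintro a _ _ ⟨u, hu, rfl⟩ ⟨v, hv, rfl⟩
    exact toRelativelyFree_eq_zero.2 (lie_mem_tIdealSpan hu hv)
  lie_swap := by
    rintro a b c _ _ _ ⟨u, hu, rfl⟩ ⟨v, hv, rfl⟩ ⟨w, hw, rfl⟩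
    exact sub_eq_zero.1
      (toRelativelyFree_eq_zero.2 (smul_lie_sub_smul_lie_mem_tIdealSpan hu hv hw))

theorem IsGradedIdentity.mem_tIdealSpan [CharZero K] {f : FreeGradedLie K ℤ}
    (hf : IsGradedIdentity (U₁.component K) f) : f ∈ tIdealSpan (basicIdentities K) := by
  have h := hf.lift_eq_zero (relativelyFreeFamily K) fun v =>
    ⟨toRelativelyFree K (FreeLieAlgebra.of K v), _, x_mem_component v.2 v.1, rfl⟩
  change FreeLieAlgebra.lift K (toRelativelyFree K ∘ FreeLieAlgebra.of K) f = 0 at h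
  rwa [FreeLieAlgebra.lift_comp_of, toRelativelyFree_eq_zero] at h

end FreeGradedLie

theorem theorem1 (K : Type*) [Field K] [CharZero K] :
    FreeGradedLie.IsBasisOfGradedIdentities (U₁.component K)
      ({f : FreeGradedLie K ℤ | ∃ i : ℤ,
          f = ⁅FreeGradedLie.x K 1 i, FreeGradedLie.x K 2 i⁆} ∪
       {f : FreeGradedLie K ℤ | ∃ a b c : ℤ,
          f = (((c - a) * (b - c - a) : ℤ) : K) •
                ⁅⁅FreeGradedLie.x K 1 a, FreeGradedLie.x K 2 b⁆, FreeGradedLie.x K 3 c⁆ -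
              (((b - a) * (c - b - a) : ℤ) : K) •
                ⁅⁅FreeGradedLie.x K 1 a, FreeGradedLie.x K 3 c⁆, FreeGradedLie.x K 2 b⁆}) := by
  intro f
  change f ∈ FreeGradedLie.tIdealSpan (FreeGradedLie.basicIdentities K) ↔ _
  exact ⟨FreeGradedLie.isGradedIdentity_of_mem_tIdealSpan,
    FreeGradedLie.IsGradedIdentity.mem_tIdealSpan⟩
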